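/- A hypergraph $\mathcal H=(V,E)$ consists of a finite set $V$ of vertices and a set $E\subset 2^V$ of edges such that no edge is properly contained in another one. For $v\in V$ the vertex-deleted subhypergraph $\mathcal H-v$ has vertex set $V\setminus\{v\}$, and its edges are the edges of $\mathcal H$ that do not contain $v$. The deck of $\mathcal H$ is the collection (with multiplicities) of the hypergraphs $\mathcal H-v$, $v\in V$, each taken up to isomorphism. Let $\mathbb K$ be a field of characteristic $0$. For a hypergraph $\mathcal H$ with vertex set $V=\{v_1,\dots,v_n\}$ let $A=\mathbb K[x_1,\dots,x_n]$, let $I_{\mathcal H}\subset A$ be the ideal generated by the squarefree monomials $\prod_{v_k\in\varepsilon}x_k$, $\varepsilon\in E$, and let $R=A/I_{\mathcal H}$, which is the Stanley-Reisner ring of the independent complex of $\mathcal H$. In the $\mathbb Z^n$-graded minimal free resolution $$\cdots\to F_2\to F_1\to F_0\to R\to 0,\qquad F_i=\bigoplus_{\mathbf b\in\mathbb Z^n}A(-\mathbf b)^{b_{i,\mathbf b}},$$ the numbers $b_{i,\mathbf b}$ are the multigraded Betti numbers of $R$, and $b_{ij}=b_{ij}(\mathcal H)=\sum_{|\mathbf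 b|=j}b_{i,\mathbf b}$, where $|\mathbf b|=b_1+\dots+b_n$, are the graded Betti numbers of $R$. Corollary 4.8. Let $n\ge 3$. The graded Betti numbers $b_{ij}$ of $R=A/I_{\mathcal H}$ are reconstructible for all $j<n$: if $\mathcal H$ and $\mathcal H'$ are hypergraphs on $n$ vertices with the same deck, that is, if there is a bijection $\sigma$ from the vertices of $\mathcal H$ to those of $\mathcal H'$ such that $\mathcal H-v$ is isomorphic to $\mathcal H'-\sigma(v)$ for every vertex $v$, then $b_{ij}(\mathcal H)=b_{ij}(\mathcal H')$ for all $i\ge 0$ and all integers $j<n$. -/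

import Mathlib

open MvPolynomial

/-- A (finite, when `V` is finite) hypergraph on the vertex set `V`: a set of subsets of `V`, the
edges, no one of which is properly contained in another. -/
structure SpernerHypergraph (V : Type*) where
  edges : Set (Finset V)
  antichain : ∀ e ∈ edges, ∀ f ∈ edges, e ⊆ f → e = f

namespace SpernerHypergraph

/-- The vertex-induced subhypergraph `H_W`: its vertices are the elements of `W`, its edges are
all the edges of `H` that are contained in `W`. -/
def induce {V : Type*} (H : SpernerHypergraph V) (W : Set V) : SpernerHypergraph W where
  edges := {e | e.map (Function.Embedding.subtype (· ∈ W)) ∈ H.edges}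
  antichain := fun _ he _ hf hef =>
    Finset.map_injective _ (H.antichain _ he _ hf (Finset.map_subset_map.2 hef))

/-- The card `H - v`: the vertex `v` is deleted, together with all the edges that contain it. -/
def deleteVertex {V : Type*} (H : SpernerHypergraph V) (v : V) :
    SpernerHypergraph ({v}ᶜ : Set V) :=
  H.induce {v}ᶜ

/-- `H` and `G` are isomorphic: some bijection of the vertices carries the edges of `H` exactly to
the edges of `G`. -/
def Isomorphic {V W : Type*} (H : SpernerHypergraph V) (G : SpernerHypergraph W) : Prop :=
  ∃ φ : V ≃ W, ∀ e : Finset V, e ∈ H.edges ↔ e.map φ.toEmbedding ∈ G.edges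

/-- `H` and `G` have the same deck, that is, the same collection (with multiplicities) of
vertex-deleted subhypergraphs up to isomorphism. -/
def SameDeck {V W : Type*} (H : SpernerHypergraph V) (G : SpernerHypergraph W) : Prop :=
  ∃ σ : V ≃ W, ∀ v : V, (H.deleteVertex v).Isomorphic (G.deleteVertex (σ v))

/-- The edge ideal `I_H` in the polynomial ring `A` with one variable for each vertex. The quotient
`A ⧸ I_H` is the Stanley-Reisner ring of the independent complex of `H`. -/
noncomputable def edgeIdeal {V : Type*} (K : Type*) [Field K] (H : SpernerHypergraph V) : Ideal (MvPolynomial V K) :=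
  Ideal.span {p | ∃ e ∈ H.edges, p = ∏ v ∈ e, X v}

end SpernerHypergraph

namespace Multigraded

variable {V K : Type*} [Field K]

/-- `p` lies in the component `A_b` of the `ℤ^V`-graded polynomial ring `A = K[x_v : v ∈ V]`: it is
a scalar multiple of `∏ v, x_v ^ (b v)` (and zero if `b` has a negative entry). -/
def IsHomog (b : V → ℤ) (p : MvPolynomial V K) : Prop :=
  ∀ m ∈ p.support, ∀ v, (m v : ℤ) = b v

/-- `f` lies in the component of degree `b` of the `ℤ^V`-graded free module `⨁ k, A(-deg k)`, whose
`k`-th basis vector has degree `deg k`: note that `A(-c)_b = A_(b - c)`. -/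
def IsHomogVec {r : ℕ} (deg : Fin r → V → ℤ) (b : V → ℤ) (f : Fin r → MvPolynomial V K) : Prop :=
  ∀ k, IsHomog (b - deg k) (f k)

/-- The maximal ideal of `A` generated by the variables. -/
noncomputable def irrelevantIdeal (V K : Type*) [Field K] : Ideal (MvPolynomial V K) :=
  Ideal.span (Set.range X)

/-- A `ℤ^V`-graded minimal free resolution of the `A`-module `A ⧸ I`
(`⋯ → F 2 → F 1 → F 0 → A ⧸ I → 0`), where `F i = ⨁ k : Fin (rank i), A(-deg i k)`. -/
structure MinimalFreeResolution (I : Ideal (MvPolynomial V K)) where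
  rank : ℕ → ℕ
  deg : (i : ℕ) → Fin (rank i) → V → ℤ
  d : (i : ℕ) → (Fin (rank (i + 1)) → MvPolynomial V K) →ₗ[MvPolynomial V K]
    (Fin (rank i) → MvPolynomial V K)
  aug : (Fin (rank 0) → MvPolynomial V K) →ₗ[MvPolynomial V K] (MvPolynomial V K ⧸ I)
  /-- the differentials are multigraded of degree zero -/
  d_homog : ∀ i b f, IsHomogVec (deg (i + 1)) b f → IsHomogVec (deg i) b (d i f)
  /-- the augmentation is multigraded of degree zero -/
  aug_homog : ∀ b f, IsHomogVec (deg 0) b f → ∃ p, IsHomog b p ∧ aug f = Ideal.Quotient.mk I p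
  aug_surjective : Function.Surjective aug
  exact_aug : Function.Exact (d 0) aug
  exact : ∀ i, Function.Exact (d (i + 1)) (d i)
  /-- minimality: the image of each differential is contained in `𝔪 F i` -/
  minimal : ∀ i, LinearMap.range (d i) ≤ irrelevantIdeal V K • ⊤

namespace MinimalFreeResolution

/-- The multigraded Betti number `b_{i,b}`: the number of summands `A(-b)` of `F i`. -/
noncomputable def multigradedBetti {I : Ideal (MvPolynomial V K)} (F : MinimalFreeResolution I)
    (i : ℕ) (b : V → ℤ) : ℕ :=
  Nat.card {k : Fin (F.rank i) // F.deg i k = b}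

/-- The graded Betti number `b_{ij}`, the sum of the `b_{i,b}` over all `b` with `|b| = j`. Only
finitely many of the summands are nonzero. -/
noncomputable def gradedBetti [Fintype V] {I : Ideal (MvPolynomial V K)}
    (F : MinimalFreeResolution I) (i : ℕ) (j : ℤ) : ℕ :=
  ∑ᶠ (b : V → ℤ) (_ : ∑ v, b v = j), F.multigradedBetti i b

end MinimalFreeResolution

end Multigraded

/-! ### Filtered vector spaces with a graded basis -/

namespace FilteredSpace

variable {K P ι κ : Type*} [Field K]

/-- The span of the basis vectors whose degree lies in `T`. -/
def supportedIn (K : Type*) [Field K] (deg : ι → P) (T : Set P) : Submodule K (ι → K) where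
  carrier := {a | ∀ k, a k ≠ 0 → deg k ∈ T}
  add_mem' {a b} ha hb k hk := by
    by_cases h : a k = 0
    · exact hb k fun h' => hk (by simp [h, h'])
    · exact ha k h
  zero_mem' k hk := absurd rfl hk
  smul_mem' c a ha k hk := ha k fun h => hk (by simp [h])

theorem supportedIn_mono (deg : ι → P) {S T : Set P} (h : S ⊆ T) :
    supportedIn K deg S ≤ supportedIn K deg T := fun _ ha k hk => h (ha k hk)

theorem single_mem_supportedIn [DecidableEq ι] (deg : ι → P) {T : Set P} {l : ι} (h : deg l ∈ T)
    (c : K) : Pi.single l c ∈ supportedIn K deg T := by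
  intro k hk
  obtain rfl : k = l := by
    by_contra hne
    exact hk (by simp [hne])
  exact h

theorem single_mem_supportedIn_Iic [DecidableEq ι] [Preorder P] (deg : ι → P) (l : ι) (c : K) :
    Pi.single l c ∈ supportedIn K deg (Set.Iic (deg l)) :=
  single_mem_supportedIn deg (Set.mem_Iic.2 le_rfl) c

variable [Fintype ι] [DecidableEq ι]

theorem map_mem_of_mem_supportedIn {E : Type*} [AddCommGroup E] [Module K E] {deg : ι → P}
    {T : Set P} {N : Submodule K E} {f : (ι → K) →ₗ[K] E}
    (hf : ∀ l, deg l ∈ T → f (Pi.single l 1) ∈ N) {a : ι → K} (ha : a ∈ supportedIn K deg T) :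
    f a ∈ N := by
  rw [LinearMap.pi_apply_eq_sum_univ f a]
  refine N.sum_mem fun l _ => ?_
  by_cases h : a l = 0
  · simp [h]
  · convert N.smul_mem (a l) (hf l (ha l h)) using 3
    ext k
    simp [Pi.single_apply, eq_comm]

theorem eq_of_mem_supportedIn {E : Type*} [AddCommGroup E] [Module K E] {deg : ι → P}
    {T : Set P} {f g : (ι → K) →ₗ[K] E}
    (hfg : ∀ l, deg l ∈ T → f (Pi.single l 1) = g (Pi.single l 1)) {a : ι → K}
    (ha : a ∈ supportedIn K deg T) : f a = g a := by
  have := map_mem_of_mem_supportedIn (N := ⊥) (f := f - g)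
    (fun l hl => by simp [hfg l hl]) ha
  simpa [sub_eq_zero] using this

variable [PartialOrder P]

/-- A linear map that does not increase the degree. -/
def IsFiltered (deg : ι → P) (deg' : κ → P) (f : (ι → K) →ₗ[K] (κ → K)) : Prop :=
  ∀ l, f (Pi.single l 1) ∈ supportedIn K deg' (Set.Iic (deg l))

theorem IsFiltered.map_mem {deg : ι → P} {deg' : κ → P} {f : (ι → K) →ₗ[K] (κ → K)}
    (hf : IsFiltered deg deg' f) {T : Set P} (hT : IsLowerSet T) {a : ι → K}
    (ha : a ∈ supportedIn K deg T) : f a ∈ supportedIn K deg' T :=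
  map_mem_of_mem_supportedIn
    (fun l hl => supportedIn_mono deg' (hT.Iic_subset hl) (hf l)) ha

/-- The analogue of lifting out of a free module: preimages are chosen on basis vectors. Those with
degree outside `Q` go to zero, so `s` is filtered everywhere although it lifts `t` only over `Q`. -/
theorem exists_filtered_lift {E : Type*} [AddCommGroup E] [Module K E] (deg : ι → P)
    (deg' : κ → P) (g : (κ → K) →ₗ[K] E) (t : (ι → K) →ₗ[K] E) (Q : Set P)
    (h : ∀ l, deg l ∈ Q → ∃ a ∈ supportedIn K deg' (Set.Iic (deg l)), g a = t (Pi.single l 1)) :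
    ∃ s : (ι → K) →ₗ[K] (κ → K), IsFiltered deg deg' s ∧
      ∀ a ∈ supportedIn K deg Q, g (s a) = t a := by
  have h' : ∀ l, ∃ a ∈ supportedIn K deg' (Set.Iic (deg l)),
      deg l ∈ Q → g a = t (Pi.single l 1) := fun l => by
    by_cases hl : deg l ∈ Q
    · obtain ⟨a, ha, hga⟩ := h l hl
      exact ⟨a, ha, fun _ => hga⟩
    · exact ⟨0, zero_mem _, fun h => absurd h hl⟩
  choose a ha hga using h'
  have hs : ∀ l, (Pi.basisFun K ι).constr K a (Pi.single l 1) = a l := fun l => by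
    rw [← Pi.basisFun_apply, Module.Basis.constr_basis]
  refine ⟨(Pi.basisFun K ι).constr K a, fun l => by rw [hs]; exact ha l, fun x hx => ?_⟩
  exact eq_of_mem_supportedIn (f := g ∘ₗ (Pi.basisFun K ι).constr K a) (g := t)
    (fun l hl => by rw [LinearMap.comp_apply, hs, hga l hl]) hx

end FilteredSpace

/-! ### Minimal scalar resolutions and their uniqueness on a lower set of degrees -/

open FilteredSpace

/-- A minimal resolution by filtered vector spaces, of the `P`-graded module that is `K` in the
degrees of `pos \ dead` and zero in all others. -/
structure ScalarResolution (K : Type*) [Field K] {P : Type*} [PartialOrder P]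
    (pos dead : Set P) where
  rank : ℕ → ℕ
  deg : (i : ℕ) → Fin (rank i) → P
  d : (i : ℕ) → (Fin (rank (i + 1)) → K) →ₗ[K] (Fin (rank i) → K)
  aug : (Fin (rank 0) → K) →ₗ[K] K
  d_filtered : ∀ i, IsFiltered (deg (i + 1)) (deg i) (d i)
  minimal : ∀ i k l, deg i k = deg (i + 1) l → d i (Pi.single l 1) k = 0
  aug_single_eq_zero : ∀ k, deg 0 k ∉ pos → aug (Pi.single k 1) = 0
  exists_aug_eq : ∀ b ∈ pos \ dead, ∀ c, ∃ a ∈ supportedIn K (deg 0) (Set.Iic b), aug a = c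
  aug_d : ∀ b ∈ pos \ dead, ∀ a ∈ supportedIn K (deg 1) (Set.Iic b), aug (d 0 a) = 0
  exists_d_zero : ∀ b, ∀ a ∈ supportedIn K (deg 0) (Set.Iic b), (b ∈ pos \ dead → aug a = 0) →
    ∃ a' ∈ supportedIn K (deg 1) (Set.Iic b), d 0 a' = a
  d_d : ∀ i, ∀ b, ∀ a ∈ supportedIn K (deg (i + 2)) (Set.Iic b), d i (d (i + 1) a) = 0
  exists_d_succ : ∀ i b, ∀ a ∈ supportedIn K (deg (i + 1)) (Set.Iic b), d i a = 0 →
    ∃ a' ∈ supportedIn K (deg (i + 2)) (Set.Iic b), d (i + 1) a' = a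

namespace ScalarResolution

variable {K P : Type*} [Field K] [PartialOrder P] {pos dead pos' dead' Q : Set P}

/-- Relabel the degrees along an order isomorphism. -/
def mapDeg {P' : Type*} [PartialOrder P'] (C : ScalarResolution K pos dead) (e : P ≃o P') :
    ScalarResolution K (e.symm ⁻¹' pos) (e.symm ⁻¹' dead) :=
  have hs : ∀ i b, supportedIn K (e ∘ C.deg i) (Set.Iic b) =
      supportedIn K (C.deg i) (Set.Iic (e.symm b)) := fun i b => by
    ext a
    exact forall₂_congr fun k _ => (e.le_symm_apply (x := C.deg i k)).symm
  { rank := C.rank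
    deg := fun i => e ∘ C.deg i
    d := C.d
    aug := C.aug
    d_filtered := fun i l => by
      rw [hs]
      simpa using C.d_filtered i l
    minimal := fun i k l h => C.minimal i k l (e.injective h)
    aug_single_eq_zero := fun k hk => C.aug_single_eq_zero k (by simpa using hk)
    exists_aug_eq := fun b hb c => by
      rw [hs]
      exact C.exists_aug_eq _ hb c
    aug_d := fun b hb => by
      rw [hs]
      exact C.aug_d _ hb
    exists_d_zero := fun b => by
      rw [hs, hs]
      exact C.exists_d_zero _
    d_d := fun i b => by
      rw [hs]
      exact C.d_d i _
    exists_d_succ := fun i b => by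
      rw [hs, hs]
      exact C.exists_d_succ i _ }

/-- The cycles of degree `b`. -/
def IsCycle (C : ScalarResolution K pos dead) : (i : ℕ) → P → (Fin (C.rank i) → K) → Prop
  | 0, b, a => b ∈ pos \ dead → C.aug a = 0
  | i + 1, _, a => C.d i a = 0

theorem isCycle_d (C : ScalarResolution K pos dead) (i : ℕ) {b : P} {a : Fin (C.rank (i + 1)) → K}
    (ha : a ∈ supportedIn K (C.deg (i + 1)) (Set.Iic b)) : C.IsCycle i b (C.d i a) := by
  cases i with
  | zero => exact fun hb => C.aug_d b hb a ha
  | succ i => exact C.d_d i b a ha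

theorem exists_d_eq (C : ScalarResolution K pos dead) (i : ℕ) {b : P} {a : Fin (C.rank i) → K}
    (ha : a ∈ supportedIn K (C.deg i) (Set.Iic b)) (hc : C.IsCycle i b a) :
    ∃ a' ∈ supportedIn K (C.deg (i + 1)) (Set.Iic b), C.d i a' = a := by
  cases i with
  | zero => exact C.exists_d_zero b a ha hc
  | succ i => exact C.exists_d_succ i b a ha hc

/-- Minimality in filtered form: the matrix entries between equal degrees vanish, so the
differential lowers the degree strictly. -/
theorem d_mem_Iio (C : ScalarResolution K pos dead) (i : ℕ) {b : P}
    {a : Fin (C.rank (i + 1)) → K} (ha : a ∈ supportedIn K (C.deg (i + 1)) (Set.Iic b)) :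
    C.d i a ∈ supportedIn K (C.deg i) (Set.Iio b) := by
  refine map_mem_of_mem_supportedIn (fun l hl k hk => ?_) ha
  exact lt_of_lt_of_le (lt_of_le_of_ne (C.d_filtered i l k hk) fun h => hk (C.minimal i k l h)) hl

theorem exists_map_zero (C : ScalarResolution K pos dead) (C' : ScalarResolution K pos' dead')
    (hQ : IsLowerSet Q) (hdead : IsUpperSet dead) (hpos' : IsUpperSet pos')
    (hpp : ∀ b ∈ Q, b ∈ pos ↔ b ∈ pos') (hdd : ∀ b ∈ Q, b ∈ dead ↔ b ∈ dead') :
    ∃ f, IsFiltered (C.deg 0) (C'.deg 0) f ∧ ∀ b ∈ Q, b ∈ pos \ dead →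
      ∀ a ∈ supportedIn K (C.deg 0) (Set.Iic b), C'.aug (f a) = C.aug a := by
  obtain ⟨f, hf, hfa⟩ := exists_filtered_lift (C.deg 0) (C'.deg 0) C'.aug C.aug
    (Q ∩ (pos \ dead)) fun l hl => C'.exists_aug_eq _
      ⟨(hpp _ hl.1).1 hl.2.1, fun h => hl.2.2 ((hdd _ hl.1).2 h)⟩ _
  refine ⟨f, hf, fun b hbQ hb a ha => ?_⟩
  refine eq_of_mem_supportedIn (T := Set.Iic b) (f := C'.aug ∘ₗ f) (g := C.aug)
    (fun l hl => ?_) ha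
  have hlQ : C.deg 0 l ∈ Q := hQ hl hbQ
  by_cases hlp : C.deg 0 l ∈ pos
  · exact hfa _ (single_mem_supportedIn (T := Q ∩ (pos \ dead)) _
      ⟨hlQ, hlp, fun h => hb.2 (hdead hl h)⟩ 1)
  -- Both sides vanish here: `f` maps the basis vector into degrees below one outside `pos'`, and
  -- these avoid the upper set `pos'` as well.
  · rw [C.aug_single_eq_zero l hlp]
    refine eq_of_mem_supportedIn (T := Set.Iic (C.deg 0 l)) (f := C'.aug) (g := 0)
      (fun k hk => ?_) (hf l)
    exact C'.aug_single_eq_zero k fun h => hlp ((hpp _ hlQ).2 (hpos' hk h))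

/-- The comparison theorem over `Q`, with the chain maps and the homotopy built together by
induction on `i`. The map `u` stands for minus the usual second homotopy term: it is zero at stage
zero and the previous homotopy after `d` later on. Only its strict lowering of degree and its
vanishing on boundaries are needed. -/
theorem exists_comparison (C : ScalarResolution K pos dead) (C' : ScalarResolution K pos' dead')
    (hQ : IsLowerSet Q) (hdead : IsUpperSet dead) (hpos : IsUpperSet pos)
    (hdead' : IsUpperSet dead') (hpos' : IsUpperSet pos')
    (hpp : ∀ b ∈ Q, b ∈ pos ↔ b ∈ pos') (hdd : ∀ b ∈ Q, b ∈ dead ↔ b ∈ dead') (i : ℕ) :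
    ∃ (f : (Fin (C.rank i) → K) →ₗ[K] (Fin (C'.rank i) → K))
      (g : (Fin (C'.rank i) → K) →ₗ[K] (Fin (C.rank i) → K))
      (h : (Fin (C.rank i) → K) →ₗ[K] (Fin (C.rank (i + 1)) → K))
      (u : (Fin (C.rank i) → K) →ₗ[K] (Fin (C.rank i) → K)),
      IsFiltered (C.deg i) (C'.deg i) f ∧ IsFiltered (C'.deg i) (C.deg i) g ∧
      IsFiltered (C.deg i) (C.deg (i + 1)) h ∧
      (∀ b ∈ Q, ∀ a ∈ supportedIn K (C.deg i) (Set.Iic b),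
        C.IsCycle i b a → C'.IsCycle i b (f a)) ∧
      (∀ b ∈ Q, ∀ a ∈ supportedIn K (C'.deg i) (Set.Iic b),
        C'.IsCycle i b a → C.IsCycle i b (g a)) ∧
      (∀ a ∈ supportedIn K (C.deg i) Q, C.d i (h a) = g (f a) - a - u a) ∧
      (∀ b, ∀ a ∈ supportedIn K (C.deg i) (Set.Iic b),
        u a ∈ supportedIn K (C.deg i) (Set.Iio b)) ∧
      (∀ b ∈ Q, ∀ a ∈ supportedIn K (C.deg (i + 1)) (Set.Iic b), u (C.d i a) = 0) := by
  induction i with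
  | zero =>
    obtain ⟨f, hf, hfa⟩ := exists_map_zero C C' hQ hdead hpos' hpp hdd
    obtain ⟨g, hg, hga⟩ := exists_map_zero C' C hQ hdead' hpos (fun b hb => (hpp b hb).symm)
      (fun b hb => (hdd b hb).symm)
    have key : ∀ b ∈ Q, b ∈ pos \ dead ↔ b ∈ pos' \ dead' := fun b hb => by
      simp [hpp b hb, hdd b hb]
    obtain ⟨h, hh, hha⟩ := exists_filtered_lift (C.deg 0) (C.deg 1) (C.d 0)
      (g ∘ₗ f - LinearMap.id) Q fun l hl => by
        have hl' := single_mem_supportedIn_Iic (C.deg 0) l (1 : K)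
        refine C.exists_d_zero _ _ (sub_mem (hg.map_mem (isLowerSet_Iic _) (hf l)) hl') fun hb => ?_
        rw [LinearMap.sub_apply, map_sub, sub_eq_zero]
        exact (hga _ hl ((key _ hl).1 hb) _ (hf l)).trans (hfa _ hl hb _ hl')
    refine ⟨f, g, h, 0, hf, hg, hh, fun b hb a ha hc hb' => ?_, fun b hb a ha hc hb' => ?_,
      fun a ha => ?_, fun b a ha => zero_mem _, fun b hb a ha => rfl⟩
    · rw [hfa b hb ((key b hb).2 hb') a ha, hc ((key b hb).2 hb')]
    · rw [hga b hb ((key b hb).1 hb') a ha, hc ((key b hb).1 hb')]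
    · simp [hha a ha]
  | succ i ih =>
    obtain ⟨f, g, h, u, hf, hg, hh, hfc, hgc, hgf, hu, hud⟩ := ih
    have hsing := fun l => single_mem_supportedIn_Iic (C.deg (i + 1)) l (1 : K)
    obtain ⟨f', hf', hfd⟩ := exists_filtered_lift (C.deg (i + 1)) (C'.deg (i + 1)) (C'.d i)
      (f ∘ₗ C.d i) Q fun l hl => by
        have hdl := C.d_filtered i l
        exact C'.exists_d_eq i (hf.map_mem (isLowerSet_Iic _) hdl)
          (hfc _ hl _ hdl (C.isCycle_d i (hsing l)))
    obtain ⟨g', hg', hgd⟩ := exists_filtered_lift (C'.deg (i + 1)) (C.deg (i + 1)) (C.d i)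
      (g ∘ₗ C'.d i) Q fun l hl => by
        have hdl := C'.d_filtered i l
        exact C.exists_d_eq i (hg.map_mem (isLowerSet_Iic _) hdl)
          (hgc _ hl _ hdl (C'.isCycle_d i (single_mem_supportedIn_Iic _ l 1)))
    simp only [LinearMap.comp_apply] at hfd hgd
    -- The map to be lifted takes values in cycles over `Q`: the previous homotopy identity, applied
    -- to a boundary, loses its `u` term.
    obtain ⟨h', hh', hhd⟩ := exists_filtered_lift (C.deg (i + 1)) (C.deg (i + 2)) (C.d (i + 1))
      (g' ∘ₗ f' - LinearMap.id - h ∘ₗ C.d i) Q fun l hl => by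
        have hdl := C.d_filtered i l
        have hlQ : (Set.Iic (C.deg (i + 1) l)) ⊆ Q := hQ.Iic_subset hl
        refine C.exists_d_succ i _ _ (sub_mem (sub_mem (hg'.map_mem (isLowerSet_Iic _) (hf' l))
          (hsing l)) (hh.map_mem (isLowerSet_Iic _) hdl)) ?_
        have h1 := hgf _ (supportedIn_mono _ hlQ hdl)
        rw [hud _ hl _ (hsing l)] at h1
        simp only [LinearMap.sub_apply, LinearMap.comp_apply, LinearMap.id_apply, map_sub, h1]
        rw [hgd _ (supportedIn_mono _ hlQ (hf' l)), hfd _ (supportedIn_mono _ hlQ (hsing l))]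
        abel
    refine ⟨f', g', h', h ∘ₗ C.d i, hf', hg', hh', fun b hb a ha hc => ?_,
      fun b hb a ha hc => ?_, fun a ha => ?_, fun b a ha => ?_, fun b hb a ha => ?_⟩
    · change C.d i a = 0 at hc
      change C'.d i (f' a) = 0
      rw [hfd a (supportedIn_mono _ (hQ.Iic_subset hb) ha), hc, map_zero]
    · change C'.d i a = 0 at hc
      change C.d i (g' a) = 0
      rw [hgd a (supportedIn_mono _ (hQ.Iic_subset hb) ha), hc, map_zero]
    · simp [hhd a ha]
    · exact hh.map_mem (isLowerSet_Iio _) (C.d_mem_Iio i ha)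
    · rw [LinearMap.comp_apply, C.d_d i b a ha, map_zero]

/-- Modulo lower degrees `g ∘ f` is the identity, since both `u` and `d` lower the degree strictly.
Hence `f` is injective on the part of degree exactly `b`, and dimensions can be compared. -/
theorem card_deg_le (C : ScalarResolution K pos dead) (C' : ScalarResolution K pos' dead')
    (hQ : IsLowerSet Q) (hdead : IsUpperSet dead) (hpos : IsUpperSet pos)
    (hdead' : IsUpperSet dead') (hpos' : IsUpperSet pos')
    (hpp : ∀ b ∈ Q, b ∈ pos ↔ b ∈ pos') (hdd : ∀ b ∈ Q, b ∈ dead ↔ b ∈ dead') (i : ℕ)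
    {b : P} (hb : b ∈ Q) :
    Nat.card {k // C.deg i k = b} ≤ Nat.card {k // C'.deg i k = b} := by
  classical
  obtain ⟨f, g, h, u, hf, hg, hh, -, -, hgf, hu, -⟩ :=
    exists_comparison C C' hQ hdead hpos hdead' hpos' hpp hdd i
  let ext : ({k // C.deg i k = b} → K) →ₗ[K] (Fin (C.rank i) → K) :=
    { toFun := fun a k => if hk : C.deg i k = b then a ⟨k, hk⟩ else 0
      map_add' := fun a a' => by ext k; by_cases hk : C.deg i k = b <;> simp [hk]
      map_smul' := fun c a => by ext k; by_cases hk : C.deg i k = b <;> simp [hk] }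
  let res : (Fin (C'.rank i) → K) →ₗ[K] ({k // C'.deg i k = b} → K) :=
    LinearMap.funLeft K K Subtype.val
  have hinj : Function.Injective (res ∘ₗ f ∘ₗ ext) := by
    rw [injective_iff_map_eq_zero]
    intro a ha
    have hext : ext a ∈ supportedIn K (C.deg i) (Set.Iic b) := fun k hk => by
      by_cases hkb : C.deg i k = b
      · exact hkb.le
      · exact absurd (dif_neg hkb) hk
    have hfa : f (ext a) ∈ supportedIn K (C'.deg i) (Set.Iio b) := fun k hk =>
      lt_of_le_of_ne (hf.map_mem (isLowerSet_Iic _) hext k hk) fun hkb =>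
        hk (congrFun ha ⟨k, hkb⟩)
    have hlt : ext a ∈ supportedIn K (C.deg i) (Set.Iio b) := by
      have h1 : ext a = g (f (ext a)) - u (ext a) - C.d i (h (ext a)) := by
        rw [hgf _ (supportedIn_mono _ (hQ.Iic_subset hb) hext)]
        abel
      rw [h1]
      exact sub_mem (sub_mem (hg.map_mem (isLowerSet_Iio _) hfa) (hu b _ hext))
        (C.d_mem_Iio i (hh.map_mem (isLowerSet_Iic _) hext))
    ext ⟨k, hk⟩
    by_contra hne
    have : ext a k ≠ 0 := by simpa [ext, hk] using hne
    exact (hlt k this).ne hk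
  have := LinearMap.finrank_le_finrank_of_injective hinj
  simpa [Nat.card_eq_fintype_card] using this

theorem card_deg_eq (C : ScalarResolution K pos dead) (C' : ScalarResolution K pos' dead')
    (hQ : IsLowerSet Q) (hdead : IsUpperSet dead) (hpos : IsUpperSet pos)
    (hdead' : IsUpperSet dead') (hpos' : IsUpperSet pos')
    (hpp : ∀ b ∈ Q, b ∈ pos ↔ b ∈ pos') (hdd : ∀ b ∈ Q, b ∈ dead ↔ b ∈ dead') (i : ℕ)
    {b : P} (hb : b ∈ Q) :
    Nat.card {k // C.deg i k = b} = Nat.card {k // C'.deg i k = b} :=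
  (card_deg_le C C' hQ hdead hpos hdead' hpos' hpp hdd i hb).antisymm
    (card_deg_le C' C hQ hdead' hpos' hdead hpos (fun b hb => (hpp b hb).symm)
      (fun b hb => (hdd b hb).symm) i hb)

end ScalarResolution

/-! ### Homogeneous polynomials and setting the variables to one -/

namespace Multigraded

variable {V K : Type*} [Field K]

/-- Each `ℤ^V`-graded component is spanned by at most one monomial, so evaluation at one loses no
information on it. -/
theorem IsHomog.coeff_eq_eval {b : V → ℤ} {p : MvPolynomial V K} (hp : IsHomog b p) {m : V →₀ ℕ}
    (hm : ∀ v, (m v : ℤ) = b v) : coeff m p = eval 1 p := by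
  classical
  have hpm : p = monomial m (coeff m p) := by
    ext m'
    by_cases h : m = m'
    · subst h
      rw [coeff_monomial, if_pos rfl]
    · rw [coeff_monomial, if_neg h]
      by_contra h'
      exact h (Finsupp.ext fun v => by
        exact_mod_cast (hm v).trans (hp m' (mem_support_iff.2 h') v).symm)
  conv_rhs => rw [hpm, eval_monomial]
  simp [Finsupp.prod]

theorem IsHomog.eq_zero_of_eval {b : V → ℤ} {p : MvPolynomial V K} (hp : IsHomog b p)
    (h : eval 1 p = 0) : p = 0 := by
  ext m
  by_contra hm
  exact hm (by rw [hp.coeff_eq_eval (hp m (mem_support_iff.2 hm)), h, coeff_zero])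

theorem IsHomog.nonneg {b : V → ℤ} {p : MvPolynomial V K} (hp : IsHomog b p) (h : eval 1 p ≠ 0) :
    0 ≤ b := by
  have hp0 : p ≠ 0 := fun h' => h (by rw [h', map_zero])
  obtain ⟨m, hm⟩ := support_nonempty.2 hp0
  exact fun v => by simp [← hp m hm v]

theorem isHomog_zero (b : V → ℤ) : IsHomog b (0 : MvPolynomial V K) := fun m hm => by simp at hm

theorem IsHomog.mul {b c : V → ℤ} {p q : MvPolynomial V K} (hp : IsHomog b p) (hq : IsHomog c q) :
    IsHomog (b + c) (p * q) := by
  classical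
  intro m hm v
  obtain ⟨m₁, h₁, m₂, h₂, rfl⟩ := Finset.mem_add.1 (support_mul p q hm)
  simp [← hp m₁ h₁ v, ← hq m₂ h₂ v]

theorem IsHomog.sum {ι : Type*} {s : Finset ι} {b : V → ℤ} {p : ι → MvPolynomial V K}
    (hp : ∀ k ∈ s, IsHomog b (p k)) : IsHomog b (∑ k ∈ s, p k) := by
  classical
  intro m hm
  obtain ⟨k, hk, hmk⟩ := Finset.mem_biUnion.1 (support_sum hm)
  exact hp k hk m hmk

theorem isHomog_monomial (m : V →₀ ℕ) (c : K) : IsHomog (fun v => (m v : ℤ)) (monomial m c) := by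
  classical
  intro m' hm' v
  rw [Finset.mem_singleton.1 (support_monomial_subset hm')]

theorem exists_exponent [Finite V] {b : V → ℤ} (hb : 0 ≤ b) :
    ∃ m : V →₀ ℕ, ∀ v, (m v : ℤ) = b v :=
  ⟨Finsupp.equivFunOnFinite.symm fun v => (b v).toNat, fun v => by simpa using hb v⟩

theorem exists_isHomog_eval_eq [Finite V] {b : V → ℤ} (hb : 0 ≤ b) (c : K) :
    ∃ p : MvPolynomial V K, IsHomog b p ∧ eval 1 p = c := by
  obtain ⟨m, hm⟩ := exists_exponent hb
  refine ⟨monomial m c, ?_, by simp [eval_monomial, Finsupp.prod]⟩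
  have := isHomog_monomial m c
  rwa [funext hm] at this

/-- The homogeneous component of degree `b`. -/
noncomputable def component (b : V → ℤ) : MvPolynomial V K →ₗ[K] MvPolynomial V K :=
  open Classical in weightedHomogeneousComponent (fun v => (Pi.single v 1 : V → ℤ)) b

theorem coeff_component (b : V → ℤ) (p : MvPolynomial V K) (m : V →₀ ℕ)
    [Decidable (∀ v, (m v : ℤ) = b v)] :
    coeff m (component b p) = if ∀ v, (m v : ℤ) = b v then coeff m p else 0 := by
  classical
  have hw : Finsupp.weight (fun v => (Pi.single v 1 : V → ℤ)) m = fun v => (m v : ℤ) := by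
    ext v
    rw [Finsupp.weight_apply, Finsupp.sum, Finset.sum_apply]
    by_cases h : m v = 0 <;> simp [Pi.single_apply, h]
  rw [component, coeff_weightedHomogeneousComponent]
  simp [hw, _root_.funext_iff]

theorem isHomog_component (b : V → ℤ) (p : MvPolynomial V K) : IsHomog b (component b p) := by
  classical
  intro m hm
  by_contra h
  rw [mem_support_iff, coeff_component, if_neg h] at hm
  exact hm rfl

theorem IsHomog.component_eq {b : V → ℤ} {p : MvPolynomial V K} (hp : IsHomog b p) :
    component b p = p := by
  classical
  ext m
  rw [coeff_component]
  split_ifs with h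
  · rfl
  · by_contra h'
    exact h (hp m (mem_support_iff.2 (Ne.symm h')))

theorem IsHomog.component_eq_zero {b c : V → ℤ} (hbc : b ≠ c) {p : MvPolynomial V K}
    (hp : IsHomog b p) : component c p = 0 := by
  classical
  ext m
  rw [coeff_component, coeff_zero]
  split_ifs with h
  · by_contra h'
    exact hbc (funext fun v => (hp m (mem_support_iff.2 h') v).symm.trans (h v))
  · rfl

variable {r s : ℕ} {deg : Fin r → V → ℤ} {deg' : Fin s → V → ℤ}

/-- The homogeneous component of degree `b` of a vector. -/
noncomputable def vecComponent (deg : Fin r → V → ℤ) (b : V → ℤ) :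
    (Fin r → MvPolynomial V K) →ₗ[K] (Fin r → MvPolynomial V K) :=
  LinearMap.pi fun k => component (b - deg k) ∘ₗ LinearMap.proj k

theorem isHomogVec_vecComponent (b : V → ℤ) (f : Fin r → MvPolynomial V K) :
    IsHomogVec deg b (vecComponent deg b f) := fun k => isHomog_component _ (f k)

theorem IsHomogVec.vecComponent_eq {b : V → ℤ} {f : Fin r → MvPolynomial V K}
    (hf : IsHomogVec deg b f) : vecComponent deg b f = f := funext fun k => (hf k).component_eq

theorem IsHomogVec.vecComponent_eq_zero {b c : V → ℤ} (hbc : b ≠ c)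
    {f : Fin r → MvPolynomial V K} (hf : IsHomogVec deg b f) : vecComponent deg c f = 0 :=
  funext fun k => (hf k).component_eq_zero fun h => hbc (sub_left_injective h)

theorem isHomogVec_single {k : Fin r} {b : V → ℤ} {p : MvPolynomial V K}
    (hp : IsHomog (b - deg k) p) : IsHomogVec deg b (Pi.single k p) := by
  intro l
  by_cases h : l = k
  · subst h
    simpa using hp
  · simpa [h] using isHomog_zero _

theorem isHomogVec_single_one (k : Fin r) :
    IsHomogVec deg (deg k) (Pi.single k (1 : MvPolynomial V K)) := by
  refine isHomogVec_single ?_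
  have := isHomog_monomial (V := V) (K := K) 0 1
  rw [← one_def] at this
  convert this using 1
  ext v
  simp

/-- By linearity it is enough to test a basis vector times a monomial, which is homogeneous. -/
theorem map_vecComponent
    (φ : (Fin r → MvPolynomial V K) →ₗ[MvPolynomial V K] (Fin s → MvPolynomial V K))
    (hφ : ∀ b f, IsHomogVec deg b f → IsHomogVec deg' b (φ f)) (b : V → ℤ)
    (f : Fin r → MvPolynomial V K) :
    φ (vecComponent deg b f) = vecComponent deg' b (φ f) := by
  suffices h : φ.restrictScalars K ∘ₗ vecComponent deg b =
      vecComponent deg' b ∘ₗ φ.restrictScalars K from LinearMap.congr_fun h f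
  refine LinearMap.pi_ext fun k p => ?_
  induction p using MvPolynomial.induction_on' with
  | add p q hp hq => rw [Pi.single_add, map_add, map_add, hp, hq]
  | monomial m c =>
    have hf : IsHomogVec deg (fun v => m v + deg k v) (Pi.single k (monomial m c)) := by
      refine isHomogVec_single ?_
      convert isHomog_monomial m c using 1
      ext v
      simp
    simp only [LinearMap.comp_apply, LinearMap.coe_restrictScalars]
    by_cases h : (fun v => m v + deg k v) = b
    · subst h
      rw [hf.vecComponent_eq, (hφ _ _ hf).vecComponent_eq]
    · rw [hf.vecComponent_eq_zero h, (hφ _ _ hf).vecComponent_eq_zero h, map_zero]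

/-- Set all variables to one in each entry. -/
noncomputable def evalVec (f : Fin r → MvPolynomial V K) : Fin r → K := fun k => eval 1 (f k)

theorem IsHomogVec.evalVec_mem {b : V → ℤ} {f : Fin r → MvPolynomial V K}
    (hf : IsHomogVec deg b f) : evalVec f ∈ supportedIn K deg (Set.Iic b) :=
  fun k hk => sub_nonneg.1 ((hf k).nonneg hk)

theorem IsHomogVec.eq_zero_of_evalVec {b : V → ℤ} {f : Fin r → MvPolynomial V K}
    (hf : IsHomogVec deg b f) (h : evalVec f = 0) : f = 0 :=
  funext fun k => (hf k).eq_zero_of_eval (congrFun h k)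

/-- Together with `IsHomogVec.evalVec_mem` and `IsHomogVec.eq_zero_of_evalVec` this identifies the
degree-`b` component of the free module with the vectors supported in degrees `≤ b`. -/
theorem exists_isHomogVec_evalVec_eq [Finite V] {b : V → ℤ} {a : Fin r → K}
    (ha : a ∈ supportedIn K deg (Set.Iic b)) :
    ∃ f : Fin r → MvPolynomial V K, IsHomogVec deg b f ∧ evalVec f = a := by
  have : ∀ k, ∃ p : MvPolynomial V K, IsHomog (b - deg k) p ∧ eval 1 p = a k := fun k => by
    by_cases h : a k = 0
    · exact ⟨0, isHomog_zero _, by simp [h]⟩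
    · exact exists_isHomog_eval_eq (sub_nonneg.2 (ha k h)) _
  choose f hf hfa using this
  exact ⟨f, hf, funext hfa⟩

/-- The linear map obtained by setting all variables to one in a matrix of polynomials. -/
noncomputable def scalarMap
    (φ : (Fin r → MvPolynomial V K) →ₗ[MvPolynomial V K] (Fin s → MvPolynomial V K)) :
    (Fin r → K) →ₗ[K] (Fin s → K) :=
  Fintype.linearCombination K fun l => evalVec (φ (Pi.single l 1))

theorem scalarMap_evalVec
    (φ : (Fin r → MvPolynomial V K) →ₗ[MvPolynomial V K] (Fin s → MvPolynomial V K))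
    (f : Fin r → MvPolynomial V K) : scalarMap φ (evalVec f) = evalVec (φ f) := by
  ext k
  have hφ : φ f = ∑ l, f l • φ (Pi.single l 1) := by
    conv_lhs => rw [pi_eq_sum_univ' f, map_sum]
    simp [← map_smul, ← Pi.single_smul]
  rw [hφ]
  simp [scalarMap, Fintype.linearCombination_apply, evalVec]

theorem evalVec_single (l : Fin r) :
    evalVec (Pi.single l (1 : MvPolynomial V K)) = Pi.single l 1 := by
  ext k
  by_cases h : k = l <;> simp [evalVec, h]

end Multigraded

/-! ### The graded components of the edge ideal -/

namespace SpernerHypergraph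

variable {V K : Type*} [Field K]

/-- The degrees that lie above the degree of some edge. -/
def deadDegrees (H : SpernerHypergraph V) : Set (V → ℤ) :=
  {b | ∃ e ∈ H.edges, ∀ v ∈ e, 0 < b v}

theorem isUpperSet_deadDegrees (H : SpernerHypergraph V) : IsUpperSet H.deadDegrees :=
  fun _ _ hab ⟨e, he, h⟩ => ⟨e, he, fun v hv => (h v hv).trans_le (hab v)⟩

/-- A monomial ideal contains a polynomial exactly when each of its monomials is divisible by a
generator; divisibility by a squarefree monomial means positive exponents on the edge. -/
theorem mem_edgeIdeal_iff (H : SpernerHypergraph V) {p : MvPolynomial V K} :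
    p ∈ H.edgeIdeal K ↔ ∀ m ∈ p.support, (fun v => (m v : ℤ)) ∈ H.deadDegrees := by
  classical
  have hgen : {p : MvPolynomial V K | ∃ e ∈ H.edges, p = ∏ v ∈ e, X v} =
      (fun m => monomial m (1 : K)) ''
        ((fun e : Finset V => ∑ v ∈ e, Finsupp.single v 1) '' H.edges) := by
    ext p
    simp only [Set.mem_ofPred_eq, Set.mem_image, exists_exists_and_eq_and]
    refine exists_congr fun e => and_congr_right fun _ => ?_
    rw [monomial_sum_one, eq_comm]
    rfl
  rw [edgeIdeal, hgen, mem_ideal_span_monomial_image]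
  refine forall₂_congr fun m _ => ?_
  simp only [Set.exists_mem_image, deadDegrees, Set.mem_ofPred_eq]
  refine exists_congr fun e => and_congr_right fun _ => ?_
  simp only [Finsupp.le_def, Finsupp.finsetSum_apply, Finsupp.single_apply]
  constructor
  · intro h v hv
    have := h v
    rw [Finset.sum_ite_eq_of_mem' _ _ _ hv] at this
    exact_mod_cast this
  · intro h v
    by_cases hv : v ∈ e
    · rw [Finset.sum_ite_eq_of_mem' _ _ _ hv]
      exact_mod_cast h v hv
    · simp [hv]

end SpernerHypergraph

namespace Multigraded

variable {V K : Type*} [Field K]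

theorem IsHomog.mem_edgeIdeal {H : SpernerHypergraph V} {b : V → ℤ} {p : MvPolynomial V K}
    (hp : IsHomog b p) (hb : b ∈ H.deadDegrees) : p ∈ H.edgeIdeal K := by
  rw [H.mem_edgeIdeal_iff]
  intro m hm
  rwa [_root_.funext (hp m hm)]

theorem IsHomog.eq_zero_of_mem_edgeIdeal {H : SpernerHypergraph V} {b : V → ℤ}
    {p : MvPolynomial V K} (hp : IsHomog b p) (hb : b ∉ H.deadDegrees)
    (h : p ∈ H.edgeIdeal K) : p = 0 := by
  rw [H.mem_edgeIdeal_iff] at h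
  by_contra hp0
  obtain ⟨m, hm⟩ := support_nonempty.2 hp0
  have := h m hm
  rw [_root_.funext (hp m hm)] at this
  exact hb this

theorem IsHomog.eval_eq_zero_of_mem_irrelevantIdeal {p : MvPolynomial V K} (hp : IsHomog 0 p)
    (h : p ∈ irrelevantIdeal V K) : eval 1 p = 0 := by
  have h0 : irrelevantIdeal V K ≤ RingHom.ker (constantCoeff : MvPolynomial V K →+* K) := by
    rw [irrelevantIdeal, Ideal.span_le]
    rintro _ ⟨v, rfl⟩
    simp
  rw [← hp.coeff_eq_eval (m := 0) (fun v => by simp)]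
  exact h0 h

/-! ### From minimal free resolutions to scalar resolutions -/

namespace MinimalFreeResolution

section

variable {I : Ideal (MvPolynomial V K)} (F : MinimalFreeResolution I)

/-- A homogeneous representative of the image of a basis vector under the augmentation. -/
noncomputable def augPoly (k : Fin (F.rank 0)) : MvPolynomial V K :=
  (F.aug_homog _ _ (isHomogVec_single_one k)).choose

theorem isHomog_augPoly (k : Fin (F.rank 0)) : IsHomog (F.deg 0 k) (F.augPoly k) :=
  (F.aug_homog _ _ (isHomogVec_single_one k)).choose_spec.1

theorem aug_single (k : Fin (F.rank 0)) :
    F.aug (Pi.single k 1) = Ideal.Quotient.mk I (F.augPoly k) :=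
  (F.aug_homog _ _ (isHomogVec_single_one k)).choose_spec.2

theorem aug_apply (f : Fin (F.rank 0) → MvPolynomial V K) :
    F.aug f = Ideal.Quotient.mk I (∑ k, f k * F.augPoly k) := by
  conv_lhs => rw [pi_eq_sum_univ' f, map_sum]
  rw [map_sum]
  refine Finset.sum_congr rfl fun k _ => ?_
  rw [map_smul, F.aug_single]
  rfl

theorem isHomog_sum_augPoly {b : V → ℤ} {f : Fin (F.rank 0) → MvPolynomial V K}
    (hf : IsHomogVec (F.deg 0) b f) : IsHomog b (∑ k, f k * F.augPoly k) :=
  IsHomog.sum fun k _ => by simpa using (hf k).mul (F.isHomog_augPoly k)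

/-- The augmentation after setting all variables to one. -/
noncomputable def scalarAug : (Fin (F.rank 0) → K) →ₗ[K] K :=
  Fintype.linearCombination K fun k => eval 1 (F.augPoly k)

theorem scalarAug_evalVec (f : Fin (F.rank 0) → MvPolynomial V K) :
    F.scalarAug (evalVec f) = eval 1 (∑ k, f k * F.augPoly k) := by
  simp [scalarAug, Fintype.linearCombination_apply, evalVec]

theorem d_single_mem (i : ℕ) (l : Fin (F.rank (i + 1))) (k : Fin (F.rank i)) :
    F.d i (Pi.single l 1) k ∈ irrelevantIdeal V K := by
  have h : irrelevantIdeal V K • (⊤ : Submodule (MvPolynomial V K) (Fin (F.rank i) → _)) ≤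
      Submodule.comap (LinearMap.proj k) (irrelevantIdeal V K) :=
    Submodule.smul_le.2 fun a ha x _ => Ideal.mul_mem_right _ _ ha
  exact h (F.minimal i (LinearMap.mem_range_self _ _))

/-- Projecting any preimage to degree `b` works because the differential is graded; exactness thus
passes to each graded component. -/
theorem exists_homog_preimage {i : ℕ} {b : V → ℤ} {f : Fin (F.rank i) → MvPolynomial V K}
    (hf : IsHomogVec (F.deg i) b f) (h : f ∈ LinearMap.range (F.d i)) :
    ∃ g, IsHomogVec (F.deg (i + 1)) b g ∧ F.d i g = f := by
  obtain ⟨g, rfl⟩ := h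
  refine ⟨vecComponent (F.deg (i + 1)) b g, isHomogVec_vecComponent b g, ?_⟩
  rw [map_vecComponent _ (F.d_homog i), hf.vecComponent_eq]

end

variable [Finite V] {H : SpernerHypergraph V} (F : MinimalFreeResolution (H.edgeIdeal K))

/-- The scalar resolution obtained by setting all variables to one. -/
noncomputable def scalarResolution : ScalarResolution K (Set.Ici (0 : V → ℤ)) H.deadDegrees where
  rank := F.rank
  deg := F.deg
  d i := scalarMap (F.d i)
  aug := F.scalarAug
  d_filtered i l := by
    rw [← evalVec_single, scalarMap_evalVec]
    exact (F.d_homog i _ _ (isHomogVec_single_one l)).evalVec_mem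
  minimal i k l h := by
    rw [← evalVec_single, scalarMap_evalVec]
    refine IsHomog.eval_eq_zero_of_mem_irrelevantIdeal ?_ (F.d_single_mem i l k)
    simpa [h] using F.d_homog i _ _ (isHomogVec_single_one l) k
  aug_single_eq_zero k hk := by
    by_contra h
    exact hk ((F.isHomog_augPoly k).nonneg (by simpa [scalarAug] using h))
  exists_aug_eq b hb c := by
    obtain ⟨m, hm⟩ := exists_exponent hb.1
    obtain ⟨f, hf⟩ := F.aug_surjective (Ideal.Quotient.mk _ (monomial m 1))
    rw [F.aug_apply, Ideal.Quotient.eq, H.mem_edgeIdeal_iff] at hf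
    -- The sum differs from the monomial only by an element of the ideal, which has no term in the
    -- non-dead degree `b`. Some summand therefore contains `m`, which yields a generator of degree
    -- `≤ b` with nonzero augmentation.
    have h1 : coeff m (∑ k, f k * F.augPoly k) ≠ 0 := fun h => by
      have := hf m (by
        classical
        simp [h, coeff_monomial])
      rw [_root_.funext hm] at this
      exact hb.2 this
    rw [coeff_sum] at h1
    obtain ⟨k, -, hk⟩ := Finset.exists_ne_zero_of_sum_ne_zero h1
    classical
    obtain ⟨m₁, -, m₂, hm₂, hadd⟩ := Finset.mem_add.1
      (support_mul _ _ (mem_support_iff.2 hk))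
    have hne : eval 1 (F.augPoly k) ≠ 0 := by
      rw [← (F.isHomog_augPoly k).coeff_eq_eval (F.isHomog_augPoly k m₂ hm₂)]
      exact mem_support_iff.1 hm₂
    refine ⟨Pi.single k (c / eval 1 (F.augPoly k)), single_mem_supportedIn _ ?_ _, ?_⟩
    · intro v
      rw [← hm v, ← F.isHomog_augPoly k m₂ hm₂ v, ← hadd]
      simp
    · simp [scalarAug, hne]
  aug_d b hb a ha := by
    obtain ⟨f, hf, rfl⟩ := exists_isHomogVec_evalVec_eq ha
    rw [scalarMap_evalVec, F.scalarAug_evalVec]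
    have h0 : F.aug (F.d 0 f) = 0 := F.exact_aug.apply_apply_eq_zero f
    rw [F.aug_apply, Ideal.Quotient.eq_zero_iff_mem] at h0
    rw [(F.isHomog_sum_augPoly (F.d_homog 0 b f hf)).eq_zero_of_mem_edgeIdeal hb.2 h0, map_zero]
  exists_d_zero b a ha h := by
    obtain ⟨f, hf, rfl⟩ := exists_isHomogVec_evalVec_eq ha
    have hq := F.isHomog_sum_augPoly hf
    have hf0 : F.aug f = 0 := by
      rw [F.aug_apply, Ideal.Quotient.eq_zero_iff_mem]
      -- In a dead degree the whole component lies in the ideal. Otherwise a nonzero value at one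
      -- would force `0 ≤ b` and contradict the cycle condition.
      by_cases hd : b ∈ H.deadDegrees
      · exact hq.mem_edgeIdeal hd
      · convert Ideal.zero_mem _
        refine hq.eq_zero_of_eval ?_
        by_contra hne
        exact hne (F.scalarAug_evalVec f ▸ h ⟨hq.nonneg hne, hd⟩)
    obtain ⟨g, hg, rfl⟩ := F.exists_homog_preimage hf ((F.exact_aug f).1 hf0)
    exact ⟨evalVec g, hg.evalVec_mem, scalarMap_evalVec _ _⟩
  d_d i b a ha := by
    obtain ⟨f, -, rfl⟩ := exists_isHomogVec_evalVec_eq ha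
    rw [scalarMap_evalVec, scalarMap_evalVec, (F.exact i).apply_apply_eq_zero f]
    ext
    simp [evalVec]
  exists_d_succ i b a ha h := by
    obtain ⟨f, hf, rfl⟩ := exists_isHomogVec_evalVec_eq ha
    rw [scalarMap_evalVec] at h
    obtain ⟨g, hg, rfl⟩ := F.exists_homog_preimage hf
      ((F.exact i f).1 ((F.d_homog i b f hf).eq_zero_of_evalVec h))
    exact ⟨evalVec g, hg.evalVec_mem, scalarMap_evalVec _ _⟩

end MinimalFreeResolution

end Multigraded

/-! ### Isomorphic cards and the degrees they determine -/

namespace SpernerHypergraph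

variable {V V' : Type*} {H : SpernerHypergraph V} {H' : SpernerHypergraph V'}

theorem mem_deleteVertex_edges_subtype [DecidableEq V] {v : V} {e : Finset V} (hv : v ∉ e) :
    e.subtype (· ∈ ({v}ᶜ : Set V)) ∈ (H.deleteVertex v).edges ↔ e ∈ H.edges := by
  have : (e.subtype (· ∈ ({v}ᶜ : Set V))).map (Function.Embedding.subtype _) = e :=
    Finset.subtype_map_of_mem fun x hx (h : x = v) => hv (h ▸ hx)
  change _ ∈ H.edges ↔ _
  rw [this]

/-- An isomorphism of vertex-deleted subhypergraphs extends to the deleted vertices. -/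
theorem Isomorphic.exists_equiv {v : V} {v' : V'}
    (h : (H.deleteVertex v).Isomorphic (H'.deleteVertex v')) :
    ∃ ψ : V ≃ V', ψ v = v' ∧
      ∀ e : Finset V, v ∉ e → (e ∈ H.edges ↔ e.map ψ.toEmbedding ∈ H'.edges) := by
  classical
  obtain ⟨φ, hφ⟩ := h
  let ψ : V ≃ V' := (Equiv.Set.sumCompl {v}).symm.trans
    ((Equiv.sumCongr (Equiv.ofUnique ({v} : Set V) ({v'} : Set V')) φ).trans
      (Equiv.Set.sumCompl {v'}))
  have hψv : ψ v = v' := by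
    simp [ψ, Equiv.Set.sumCompl_symm_apply_of_mem (Set.mem_singleton v)]
  have hψ : ∀ x : ({v}ᶜ : Set V), ψ x = φ x := fun x => by
    simp [ψ, Equiv.Set.sumCompl_symm_apply_of_notMem x.2]
  refine ⟨ψ, hψv, fun e he => ?_⟩
  have he' : v' ∉ e.map ψ.toEmbedding := by
    rw [← hψv]
    simpa using he
  rw [← mem_deleteVertex_edges_subtype he, ← mem_deleteVertex_edges_subtype he', hφ]
  convert Iff.rfl using 2
  ext y
  obtain ⟨x, rfl⟩ := φ.surjective y
  simp [← hψ]

/-- An edge on which `b` is positive cannot contain `v`, so it is visible in the card. -/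
theorem mem_deadDegrees_iff_comp {ψ : V ≃ V'} {v : V}
    (hψ : ∀ e : Finset V, v ∉ e → (e ∈ H.edges ↔ e.map ψ.toEmbedding ∈ H'.edges)) {b : V → ℤ}
    (hb : b v ≤ 0) : b ∈ H.deadDegrees ↔ b ∘ ψ.symm ∈ H'.deadDegrees := by
  constructor
  · rintro ⟨e, he, hpos⟩
    refine ⟨_, (hψ e fun hv => (hpos v hv).not_ge hb).1 he, fun x hx => ?_⟩
    obtain ⟨y, hy, rfl⟩ := Finset.mem_map.1 hx
    simpa using hpos y hy
  · rintro ⟨e, he, hpos⟩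
    have hpos' : ∀ x ∈ e.map ψ.symm.toEmbedding, 0 < b x := fun x hx => by
      obtain ⟨y, hy, rfl⟩ := Finset.mem_map.1 hx
      exact hpos y hy
    refine ⟨_, (hψ _ fun hv => (hpos' v hv).not_ge hb).2 ?_, hpos'⟩
    rw [Finset.map_map]
    convert he
    convert Finset.map_refl
    ext x
    simp

end SpernerHypergraph

/-! ### Distributing the graded Betti numbers over the vertices -/

namespace Multigraded

theorem sum_comp_eq_sum_card_fiber {ι B R : Type*} [Fintype ι] [AddCommMonoid R] (f : ι → B)
    {w : B → R} (T : Finset B) (hT : ∀ k, f k ∈ T) :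
    ∑ k, w (f k) = ∑ b ∈ T, Nat.card {k // f k = b} • w b := by
  classical
  rw [← Finset.sum_fiberwise_of_maps_to (fun k _ => hT k)]
  refine Finset.sum_congr rfl fun b _ => ?_
  rw [Finset.sum_congr rfl (g := fun _ => w b) fun k hk => by rw [(Finset.mem_filter.1 hk).2]]
  rw [Finset.sum_const, Nat.card_eq_fintype_card, Fintype.card_subtype]

theorem sum_comp_eq_of_card_fiber_eq {ι κ B R : Type*} [Fintype ι] [Fintype κ] [AddCommMonoid R]
    {f : ι → B} {g : κ → B} {w : B → R}
    (h : ∀ b, w b ≠ 0 → Nat.card {k // f k = b} = Nat.card {k // g k = b}) :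
    ∑ k, w (f k) = ∑ k, w (g k) := by
  classical
  rw [sum_comp_eq_sum_card_fiber f (Finset.univ.image f ∪ Finset.univ.image g) (by simp),
    sum_comp_eq_sum_card_fiber g (Finset.univ.image f ∪ Finset.univ.image g) (by simp)]
  refine Finset.sum_congr rfl fun b _ => ?_
  by_cases hb : w b = 0
  · simp [hb]
  · rw [h b hb]

/-- The share of the vertex `v` in a degree `b` of total degree `j`: the unit is distributed evenly
among the vertices at which `b` is not positive. -/
noncomputable def share {V : Type*} [Fintype V] (j : ℤ) (v : V) (b : V → ℤ) : ℚ :=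
  open Classical in
  if ∑ x, b x = j ∧ b v ≤ 0 then (Nat.card {x // b x ≤ 0} : ℚ)⁻¹ else 0

theorem share_comp {V V' : Type*} [Fintype V] [Fintype V'] (ψ : V ≃ V') (j : ℤ) (v : V)
    (b : V' → ℤ) : share j v (b ∘ ψ) = share j (ψ v) b := by
  have h1 : ∑ x, (b ∘ ψ) x = ∑ x, b x := Equiv.sum_comp ψ b
  have h2 : Nat.card {x // (b ∘ ψ) x ≤ 0} = Nat.card {x // b x ≤ 0} :=
    Nat.card_congr (ψ.subtypeEquiv fun _ => Iff.rfl)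
  simp only [share, h1, h2]
  rfl

/-- The bound on `j` enters here: a degree with all entries at least one has total degree at least
the number of vertices, so there is always a vertex to receive a share. -/
theorem sum_share {V : Type*} [Fintype V] {j : ℤ} (hj : j < Fintype.card V) (b : V → ℤ) :
    ∑ v, share j v b = if ∑ x, b x = j then 1 else 0 := by
  classical
  simp only [share]
  split_ifs with h
  · have hne : Nat.card {x // b x ≤ 0} ≠ 0 := fun h0 => by
      have hpos : ∀ x, 1 ≤ b x := fun x => by
        by_contra hx
        rw [Finite.card_eq_zero_iff] at h0
        exact h0.false ⟨x, by lia⟩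
      have := Finset.sum_le_sum fun x (_ : x ∈ Finset.univ) => hpos x
      simp only [Finset.sum_const, Finset.card_univ, nsmul_eq_mul, mul_one] at this
      lia
    simp only [h, true_and]
    rw [← Finset.sum_filter, Finset.sum_const, ← Fintype.card_subtype, ← Nat.card_eq_fintype_card,
      nsmul_eq_mul, mul_inv_cancel₀ (by exact_mod_cast hne)]
  · simp [h]

namespace MinimalFreeResolution

variable {V V' K : Type*} [Field K]

theorem gradedBetti_eq_sum [Fintype V] {I : Ideal (MvPolynomial V K)}
    (F : MinimalFreeResolution I) (i : ℕ) (j : ℤ) :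
    F.gradedBetti i j = ∑ k, if ∑ v, F.deg i k v = j then 1 else 0 := by
  classical
  rw [gradedBetti, finsum_eq_sum_of_support_subset (s := Finset.univ.image (F.deg i))]
  · rw [Finset.sum_boole, Nat.cast_id, Finset.card_eq_sum_card_fiberwise (f := F.deg i)
      (t := Finset.univ.image (F.deg i)) fun k _ => by simp]
    refine Finset.sum_congr rfl fun b _ => ?_
    rw [finsum_eq_if, multigradedBetti, Nat.card_eq_fintype_card, Fintype.card_subtype,
      Finset.filter_filter]
    split_ifs with h
    · congr 1
      ext k
      simp only [Finset.mem_filter, Finset.mem_univ, true_and]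
      exact ⟨fun hk => ⟨by rw [hk, h], hk⟩, And.right⟩
    · symm
      rw [Finset.card_eq_zero, Finset.filter_eq_empty_iff]
      rintro k - ⟨hk, rfl⟩
      exact h hk
  · intro b hb
    by_contra hb'
    refine hb ?_
    have : IsEmpty {k // F.deg i k = b} := ⟨fun k => hb' (by simp [← k.2])⟩
    simp [multigradedBetti]

/-- In degrees `b` with `b v ≤ 0`, the multigraded Betti numbers depend only on `H - v`. -/
theorem multigradedBetti_eq [Finite V] [Finite V'] {H : SpernerHypergraph V}
    {H' : SpernerHypergraph V'} (F : MinimalFreeResolution (H.edgeIdeal K))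
    (F' : MinimalFreeResolution (H'.edgeIdeal K)) {ψ : V ≃ V'} {v : V}
    (hψ : ∀ e : Finset V, v ∉ e → (e ∈ H.edges ↔ e.map ψ.toEmbedding ∈ H'.edges)) (i : ℕ)
    {b : V → ℤ} (hb : b v ≤ 0) :
    Nat.card {k // F.deg i k = b} = Nat.card {k // F'.deg i k ∘ ψ = b} := by
  let e : (V' → ℤ) ≃o (V → ℤ) :=
    { toEquiv := ψ.symm.arrowCongr (Equiv.refl ℤ)
      map_rel_iff' := fun {a b} => ψ.forall_congr_left (p := fun x => a (ψ x) ≤ b (ψ x)) |>.trans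
        (by simp [Pi.le_def]) }
  -- After relabelling along `ψ`, the two resolutions have the same nonnegative degrees, and the
  -- same dead degrees within this lower set.
  refine F.scalarResolution.card_deg_eq (F'.scalarResolution.mapDeg e) (Q := {b : V → ℤ | b v ≤ 0})
    (fun a b hba ha => (hba v).trans ha) H.isUpperSet_deadDegrees (isUpperSet_Ici 0)
    (H'.isUpperSet_deadDegrees.preimage e.symm.monotone)
    ((isUpperSet_Ici 0).preimage e.symm.monotone) (fun c _ => ?_)
    (fun c (hc : c v ≤ 0) => SpernerHypergraph.mem_deadDegrees_iff_comp hψ hc) i hb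
  rw [Set.mem_preimage, Set.mem_Ici, Set.mem_Ici, ← e.symm.le_iff_le]
  rfl

end MinimalFreeResolution

end Multigraded

theorem corollary4p8 {K : Type*} [Field K] [CharZero K] {V V' : Type*} [Fintype V] [Fintype V']
    (n : ℕ) (hn : 3 ≤ n) (H : SpernerHypergraph V) (H' : SpernerHypergraph V')
    (hV : Fintype.card V = n) (hV' : Fintype.card V' = n) (hdeck : H.SameDeck H')
    (F : Multigraded.MinimalFreeResolution (H.edgeIdeal K))
    (F' : Multigraded.MinimalFreeResolution (H'.edgeIdeal K))
    (i : ℕ) (j : ℤ) (hj : j < n) :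
    F.gradedBetti i j = F'.gradedBetti i j := by
  obtain ⟨σ, hσ⟩ := hdeck
  suffices h : (F.gradedBetti i j : ℚ) = F'.gradedBetti i j from by exact_mod_cast h
  rw [F.gradedBetti_eq_sum, F'.gradedBetti_eq_sum]
  push_cast
  -- Each generator of total degree `j` is replaced by the sum of its shares; exchanging the sums
  -- then lets the cards be compared one at a time along `σ`.
  simp only [← Multigraded.sum_share (hV ▸ hj), ← Multigraded.sum_share (hV' ▸ hj)]
  rw [Finset.sum_comm, Finset.sum_comm (s := Finset.univ (α := Fin (F'.rank i))), ← Equiv.sum_comp σ]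
  refine Finset.sum_congr rfl fun v _ => ?_
  obtain ⟨ψ, hψv, hψ⟩ := (hσ v).exists_equiv
  simp only [← hψv, ← Multigraded.share_comp ψ]
  -- A nonzero share at `v` forces `b v ≤ 0`, which is the range where the Betti numbers agree.
  refine Multigraded.sum_comp_eq_of_card_fiber_eq (f := F.deg i) (g := fun k => F'.deg i k ∘ ψ)
    fun b hb => F.multigradedBetti_eq F' hψ i ?_
  by_contra hbv
  exact hb (if_neg fun h => hbv h.2)
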